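/- \textbf{Setting.} Let $(\mathfrak X,\mathscr X)$ be a measurable space with a $\sigma$-finite measure $\mu$, and let $f_0,f_1$ be probability densities with respect to $\mu$ with $\mu\{f_0\neq f_1\}>0$; the hypothesis $H_i$ states that the observations have density $f_i$ $(i=0,1)$. Observations arrive in groups $k=1,2,\dots$ of independent random sizes $\nu_k$ with probability mass functions $p_k$ on a set $\mathscr G\subset\{0,1,2,\dots\}$; given the sizes, the observations are i.i.d. For $n=(n_1,\dots,n_k)\in\mathscr G^k$ let $p(n)=\prod_{i} p_i(n_i)$, $\mathfrak X^n=\mathfrak X^{n_1}\times\dots\times\mathfrak X^{n_k}$, let $f_i^{(n)}(x)=\prod_{l=1}^{k}\prod_{j=1}^{n_l}f_i(x_{lj})$ be the joint density with respect to the product measure on $\mathfrak X^n$, let $E_i$ and $P_i$ be the corresponding expectation and probability, and let $z_n=f_1^{(n)}/f_0^{(n)}$ (with value $\infty$ where $f_0^{(n)}=0<f_1^{(n)}$ and $0$ where both vanish). A group of $m\in\mathscr G$ observations costs $c(m)>0$; put $c(n)=\sum_{i}c(n_i)$ and $\bar c_k=\sum_{m\in\mathscr G}p_k(m)c(m)$,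 and assume $\bar c_k<\infty$ for all $k\ge1$. A test is a pair $(\psi,\phi)$ of families of measurable functions $\psi_n,\phi_n:\mathfrak X^n\to[0,1]$, $n\in\mathscr G^k$, $k\ge 1$ (the conditional probabilities to stop, respectively to reject $H_0$). Let $$t_n^\psi=\prod_{j=1}^{k-1}\bigl(1-\psi_{(n_1,\dots,n_j)}\bigr),\qquad s_n^\psi=t_n^\psi\psi_n,$$ and let $$\alpha(\psi,\phi)=\sum_{k\ge1}\sum_{n\in\mathscr G^k}p(n)E_0 s_n^\psi\phi_n,\quad \beta(\psi,\phi)=\sum_{k\ge1}\sum_{n\in\mathscr G^k}p(n)E_1 s_n^\psi(1-\phi_n),\quad K_0(\psi)=\sum_{k\ge1}\sum_{n\in\mathscr G^k}p(n)c(n)E_0 s_n^\psi .$$ Let $\mathscr S_0$ be the set of tests with $\sum_{k\ge1}\sum_{n\in\mathscr G^k}p(n)E_0 s_n^\psi=1$. Fix $\lambda_0,\lambda_1>0$. Let $g(z)=\min\{\lambda_0,\lambda_1 z\}$, $V_N^N=g$, $$V_{k-1}^N(z)=\min\Bigl\{g(z),\ \bar c_k+\sum_{m\in\mathscr G}p_k(m)E_0V_k^N(z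 z_m)\Bigr\}\quad(k=N,\dots,2),$$ $V_k=\lim_{N\to\infty}V_k^N$ (this limit exists) and $\bar V_k(z)=\sum_{m\in\mathscr G}p_k(m)E_0V_k(z z_m)$. Write $a\simeq I_{\{F_1\preccurlyeq F_2\}}$ if $I_{\{F_1<F_2\}}\le a\le I_{\{F_1\le F_2\}}$. \textbf{Condition $\mathfrak S_\infty(\psi)$.} For all $k\ge1$ and $n\in\mathscr G^k$ with $p(n)>0$: $\psi_n\simeq I_{\{g(z_n)\preccurlyeq \bar c_{k+1}+\bar V_{k+1}(z_n)\}}$ $P_0$-almost surely on $\{t_n^\psi>0\}$. \textbf{Condition $\mathfrak D(\psi,\phi)$.} For all $k\ge1$ and $n\in\mathscr G^k$ with $p(n)>0$: $\phi_n\simeq I_{\{\lambda_0/\lambda_1\preccurlyeq z_n\}}$ both $P_0$-almost surely and $P_1$-almost surely on $\{s_n^\psi>0\}$. \textbf{Statement.} Let $(\psi,\phi)\in\mathscr S_0$ satisfy Conditions $\mathfrak S_\infty(\psi)$ and $\mathfrak D(\psi,\phi)$. Then for every test $(\psi',\phi')\in\mathscr S_0$ with $$\alpha(\psi',\phi')\le\alpha(\psi,\phi)\quad\text{and}\quad\beta(\psi',\phi')\le\beta(\psi,\phi)$$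 we have $K_0(\psi')\ge K_0(\psi)$. This inequality is strict if at least one of the two inequalities between the error probabilities is strict. If all three inequalities are equalities, then Conditions $\mathfrak S_\infty(\psi')$ and $\mathfrak D(\psi',\phi')$ hold. -/

import Mathlib

open MeasureTheory Filter
open scoped ENNReal NNReal

/-- The data of the testing problem of two simple hypotheses `H₀` and `H₁` with observations taken
in groups of random sizes.  Groups are numbered `k = 1, 2, …`; the values of `p` at `0` are never
used. -/
structure GroupSequentialModel (X : Type*) [MeasurableSpace X] where
  /-- the set of possible group sizes -/
  G : Set ℕ
  /-- `p k` is the probability mass function of the size `ν_k` of the `k`-th group -/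
  p : ℕ → PMF G
  /-- the dominating measure -/
  μ : Measure X
  sigmaFinite : SigmaFinite μ
  /-- `f i` is the density of one observation under the hypothesis `H_i` -/
  f : Fin 2 → X → ℝ≥0
  measurable_f : ∀ i, Measurable (f i)
  lintegral_f : ∀ i, ∫⁻ x, f i x ∂μ = 1
  /-- the two hypothesized distributions are distinct -/
  distinct : 0 < μ {x | f 0 x ≠ f 1 x}
  /-- `c m` is the cost of a group of `m` observations -/
  c : G → ℝ≥0
  c_pos : ∀ m, 0 < c m
  /-- the average cost of every group is finite -/
  avgCost_lt_top : ∀ k, 1 ≤ k → ∑' m : G, p k m * (c m : ℝ≥0∞) < ∞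

namespace GroupSequentialModel

variable {X : Type*} [MeasurableSpace X] (M : GroupSequentialModel X)

instance : SigmaFinite M.μ := M.sigmaFinite

/-- The sample space `𝔛^n = 𝔛^{n₁} × ⋯ × 𝔛^{n_k}` of the first `k` groups of sizes `n₁, …, n_k`. -/
abbrev Data {k : ℕ} (n : Fin k → M.G) : Type _ :=
  (i : Fin k) → Fin (n i : ℕ) → X

/-- The product measure `μ^n = μ^{n₁} ⊗ ⋯ ⊗ μ^{n_k}`. -/
noncomputable def dataMeasure {k : ℕ} (n : Fin k → M.G) : Measure (M.Data n) :=
  Measure.pi fun i => Measure.pi fun _ : Fin (n i : ℕ) => M.μ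

/-- The joint density `f_i^{(n)}` of the first `k` groups under `H_i`, given their sizes. -/
def jointDensity (i : Fin 2) {k : ℕ} (n : Fin k → M.G) (x : M.Data n) : ℝ≥0 :=
  ∏ l : Fin k, ∏ j : Fin (n l : ℕ), M.f i (x l j)

/-- The distribution under `H_i` of the first `k` groups of observations, given their sizes. -/
noncomputable def law (i : Fin 2) {k : ℕ} (n : Fin k → M.G) : Measure (M.Data n) :=
  (M.dataMeasure n).withDensity fun x => (M.jointDensity i n x : ℝ≥0∞)

/-- The expectation `E_i F_n` of a nonnegative function of the observations. -/
noncomputable def expect (i : Fin 2) {k : ℕ} (n : Fin k → M.G) (F : M.Data n → ℝ≥0∞) : ℝ≥0∞ :=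
  ∫⁻ x, F x ∂M.law i n

/-- The joint probability mass function `p(n) = p₁(n₁) ⋯ p_k(n_k)` of the first `k` group sizes. -/
noncomputable def sizeProb {k : ℕ} (n : Fin k → M.G) : ℝ≥0∞ :=
  ∏ l : Fin k, M.p ((l : ℕ) + 1) (n l)

/-- The cost `c(n) = c(n₁) + ⋯ + c(n_k)` of the first `k` groups. -/
noncomputable def cost {k : ℕ} (n : Fin k → M.G) : ℝ≥0∞ :=
  ∑ l : Fin k, (M.c (n l) : ℝ≥0∞)

/-- The average cost `c̄_k` of the `k`-th group. -/
noncomputable def avgCost (k : ℕ) : ℝ≥0∞ :=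
  ∑' m : M.G, M.p k m * (M.c m : ℝ≥0∞)

/-- The likelihood ratio `z_n`.  In `ℝ≥0∞` the quotient is `∞` when only the denominator vanishes,
and `0` when both vanish. -/
noncomputable def ratio {k : ℕ} (n : Fin k → M.G) (x : M.Data n) : ℝ≥0∞ :=
  (M.jointDensity 1 n x : ℝ≥0∞) / (M.jointDensity 0 n x : ℝ≥0∞)

/-- A stopping rule or a decision rule: a family of measurable functions `𝔛^n → [0, 1]`, one for
each tuple `n` of sizes of the first `k + 1` groups, `k = 0, 1, …`. -/
structure Rule where
  toFun : ∀ {k : ℕ} (n : Fin (k + 1) → M.G), M.Data n → ℝ≥0∞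
  measurable_toFun : ∀ {k : ℕ} (n : Fin (k + 1) → M.G), Measurable (toFun n)
  le_one : ∀ {k : ℕ} (n : Fin (k + 1) → M.G) (x : M.Data n), toFun n x ≤ 1

instance : CoeFun M.Rule (fun _ => ∀ {k : ℕ} (n : Fin (k + 1) → M.G), M.Data n → ℝ≥0∞) :=
  ⟨Rule.toFun⟩

variable {M}

/-- The conditional probability `t_n^ψ` of not having stopped after any of the groups before the
last one in `n`. -/
noncomputable def Rule.t (ψ : M.Rule) {k : ℕ} (n : Fin (k + 1) → M.G) (x : M.Data n) : ℝ≥0∞ :=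
  ∏ j : Fin k,
    (1 - ψ (k := j)
      (fun i => n (Fin.castLE (Nat.succ_le_succ j.isLt.le) i))
      (fun i => x (Fin.castLE (Nat.succ_le_succ j.isLt.le) i)))

/-- The conditional probability `s_n^ψ` of stopping exactly after the last group in `n`. -/
noncomputable def Rule.s (ψ : M.Rule) {k : ℕ} (n : Fin (k + 1) → M.G) (x : M.Data n) : ℝ≥0∞ :=
  ψ.t n x * ψ n x

variable (M)

/-- The class `ℱ_i` of the stopping rules that terminate with probability one under `H_i`. -/
def terminating (i : Fin 2) : Set M.Rule :=
  {ψ | ∑' k : ℕ, ∑' n : Fin (k + 1) → M.G, M.sizeProb n * M.expect i n (ψ.s n) = 1}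

/-- The class `𝒮_i` of the tests `(ψ, φ)` whose stopping rule belongs to `ℱ_i`. -/
def tests (i : Fin 2) : Set (M.Rule × M.Rule) :=
  {T | T.1 ∈ M.terminating i}

/-- The type I error probability. -/
noncomputable def typeOneError (ψ φ : M.Rule) : ℝ≥0∞ :=
  ∑' k : ℕ, ∑' n : Fin (k + 1) → M.G,
    M.sizeProb n * M.expect 0 n (fun x => ψ.s n x * φ n x)

/-- The type II error probability. -/
noncomputable def typeTwoError (ψ φ : M.Rule) : ℝ≥0∞ :=
  ∑' k : ℕ, ∑' n : Fin (k + 1) → M.G,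
    M.sizeProb n * M.expect 1 n (fun x => ψ.s n x * (1 - φ n x))

/-- The average total cost `K_i(ψ)` under `H_i`. -/
noncomputable def avgTotalCost (i : Fin 2) (ψ : M.Rule) : ℝ≥0∞ :=
  ∑' k : ℕ, ∑' n : Fin (k + 1) → M.G, M.sizeProb n * M.cost n * M.expect i n (ψ.s n)

/-- `a ≃ I_{F₁ ≼ F₂}`. -/
def IsIndicatorLE (a F₁ F₂ : ℝ≥0∞) : Prop :=
  (if F₁ < F₂ then 1 else 0) ≤ a ∧ a ≤ (if F₁ ≤ F₂ then 1 else 0)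

/-- `g(z) = min {λ₀, λ₁ z}`. -/
noncomputable def g (lam₀ lam₁ : ℝ≥0) (z : ℝ≥0∞) : ℝ≥0∞ :=
  min (lam₀ : ℝ≥0∞) (lam₁ * z)

/-- `∑_m p_k(m) E₀ V(z z_m)`, the sum running over the possible sizes `m` of the `k`-th group. -/
noncomputable def nextMean (k : ℕ) (V : ℝ≥0∞ → ℝ≥0∞) (z : ℝ≥0∞) : ℝ≥0∞ :=
  ∑' m : M.G, M.p k m *
    M.expect 0 (fun _ : Fin 1 => m) (fun x => V (z * M.ratio (fun _ : Fin 1 => m) x))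

/-- `truncV lam₀ lam₁ r k` is the function `V_k^N` of the backward induction with horizon
`N = k + r`. -/
noncomputable def truncV (lam₀ lam₁ : ℝ≥0) : ℕ → ℕ → ℝ≥0∞ → ℝ≥0∞
  | 0, _, z => g lam₀ lam₁ z
  | r + 1, k, z =>
      min (g lam₀ lam₁ z) (M.avgCost (k + 1) + M.nextMean (k + 1) (truncV lam₀ lam₁ r (k + 1)) z)

/-- `V_k(z) = lim_{N → ∞} V_k^N(z)`. -/
noncomputable def V (lam₀ lam₁ : ℝ≥0) (k : ℕ) (z : ℝ≥0∞) : ℝ≥0∞ :=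
  limUnder atTop fun r => M.truncV lam₀ lam₁ r k z

/-- `V̄_k(z) = ∑_m p_k(m) E₀ V_k(z z_m)`. -/
noncomputable def Vbar (lam₀ lam₁ : ℝ≥0) (k : ℕ) (z : ℝ≥0∞) : ℝ≥0∞ :=
  M.nextMean k (M.V lam₀ lam₁ k) z

theorem nextMean_mono (k : ℕ) {V W : ℝ≥0∞ → ℝ≥0∞} (h : V ≤ W) : M.nextMean k V ≤ M.nextMean k W :=
  fun _ => ENNReal.tsum_le_tsum fun _ =>
    mul_le_mul_right (lintegral_mono fun _ => h _) _

theorem truncV_antitone (lam₀ lam₁ : ℝ≥0) (k : ℕ) (z : ℝ≥0∞) :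
    Antitone fun r => M.truncV lam₀ lam₁ r k z := by
  refine antitone_nat_of_succ_le fun r => ?_
  induction r generalizing k z with
  | zero => simp only [truncV]; exact min_le_left _ _
  | succ r ih =>
    rw [truncV, truncV]
    exact min_le_min le_rfl (add_le_add le_rfl (M.nextMean_mono (k + 1) (fun w => ih (k + 1) w) z))

/-- The limit that defines `V_k` exists. -/
theorem tendsto_truncV (lam₀ lam₁ : ℝ≥0) (k : ℕ) (z : ℝ≥0∞) :
    Tendsto (fun r => M.truncV lam₀ lam₁ r k z) atTop (nhds (M.V lam₀ lam₁ k z)) :=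
  tendsto_nhds_limUnder ⟨_, tendsto_atTop_iInf (M.truncV_antitone lam₀ lam₁ k z)⟩

/-- Condition `𝔖_∞(ψ)`. -/
def ConditionS (lam₀ lam₁ : ℝ≥0) (ψ : M.Rule) : Prop :=
  ∀ (k : ℕ) (n : Fin (k + 1) → M.G), 0 < M.sizeProb n →
    ∀ᵐ x ∂M.law 0 n, 0 < ψ.t n x →
      IsIndicatorLE (ψ n x) (g lam₀ lam₁ (M.ratio n x))
        (M.avgCost (k + 2) + M.Vbar lam₀ lam₁ (k + 2) (M.ratio n x))

/-- Condition `𝔇(ψ, φ)`: the decision is the Bayes decision almost surely, under `H₀` and under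
`H₁`, on the set where `s_n^ψ > 0`. -/
def ConditionD (lam₀ lam₁ : ℝ≥0) (ψ φ : M.Rule) : Prop :=
  ∀ (k : ℕ) (n : Fin (k + 1) → M.G), 0 < M.sizeProb n → ∀ i : Fin 2,
    ∀ᵐ x ∂M.law i n, 0 < ψ.s n x →
      IsIndicatorLE (φ n x) ((lam₀ : ℝ≥0∞) / (lam₁ : ℝ≥0∞)) (M.ratio n x)

end GroupSequentialModel

/-! The proof is a Lagrange multiplier argument. For every rule that stops almost surely under `H₀`
at finite cost, `lagrangian_eq` writes `K₀ + λ₀ α + λ₁ β` as a constant `initialValue`, independent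
of the test, plus two nonnegative excesses. The stopping excess vanishes exactly under Condition
`𝔖_∞` (`conditionS_iff`), the decision excess exactly under Condition `𝔇` (`conditionD_iff`). So a
test satisfying both minimizes the Lagrangian. A competitor with no larger errors then costs at
least as much, strictly more if an error is strictly smaller, and in case of equality both its
excesses vanish.

The decision excess comes from the pointwise loss comparison between `λ₀ f₀` and `λ₁ f₁`. The
stopping excess comes from the Bellman equation `V_eq`: one step of it, averaged over the data,
gives `mean_t_add_stoppingExcess`, which telescopes up to a remainder `E₀ t (c + V)`. This tends to
zero since `V ≤ λ₀`, the continuation probability tends to zero, and the cost accumulated before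
stopping is controlled by a tail of the series for `K₀`.

All quantities live in `ℝ≥0∞`, so the identities are stated as sums and cancellation needs
finiteness. -/

/-- Splitting off the last coordinate, as a measurable equivalence. -/
def MeasurableEquiv.piFinSnoc {k : ℕ} (α : Fin (k + 1) → Type*) [∀ i, MeasurableSpace (α i)] :
    (∀ i, α i) ≃ᵐ (∀ i : Fin k, α i.castSucc) × α (Fin.last k) where
  toFun x := (fun i => x i.castSucc, x (Fin.last k))
  invFun y := Fin.snoc y.1 y.2
  left_inv x := by
    funext i
    refine Fin.lastCases ?_ (fun i => ?_) i <;> simp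
  right_inv y := by simp
  measurable_toFun := (measurable_pi_iff.2 fun _ => measurable_pi_apply _).prodMk
    (measurable_pi_apply _)
  measurable_invFun := measurable_pi_iff.2 fun i => by
    refine Fin.lastCases ?_ (fun i => ?_) i
    · simpa using! measurable_snd
    · simpa using! (measurable_pi_apply i).comp measurable_fst

theorem MeasureTheory.measurePreserving_piFinSnoc {k : ℕ} {α : Fin (k + 1) → Type*}
    [∀ i, MeasurableSpace (α i)] (μ : ∀ i, Measure (α i)) [∀ i, SigmaFinite (μ i)] :
    MeasurePreserving (MeasurableEquiv.piFinSnoc α) (Measure.pi μ)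
      ((Measure.pi fun i : Fin k => μ i.castSucc).prod (μ (Fin.last k))) := by
  set e := (MeasurableEquiv.piFinSnoc α).symm
  refine MeasurePreserving.symm e ?_
  refine ⟨e.measurable, (Measure.pi_eq fun s _ => ?_).symm⟩
  have : e ⁻¹' Set.univ.pi s
      = (Set.univ.pi fun i : Fin k => s i.castSucc) ×ˢ s (Fin.last k) := by
    ext ⟨x, y⟩
    simp [e, MeasurableEquiv.piFinSnoc, Fin.forall_fin_succ']
  rw [e.map_apply, this, Measure.prod_prod, Measure.pi_pi, Fin.prod_univ_castSucc]

theorem MeasureTheory.lintegral_pi_finSnoc {k : ℕ} {α : Fin (k + 1) → Type*}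
    [∀ i, MeasurableSpace (α i)] (μ : ∀ i, Measure (α i)) [∀ i, SigmaFinite (μ i)]
    (F : (∀ i : Fin k, α i.castSucc) × α (Fin.last k) → ℝ≥0∞) (hF : Measurable F) :
    ∫⁻ x, F (fun i => x i.castSucc, x (Fin.last k)) ∂Measure.pi μ =
      ∫⁻ a, ∫⁻ b, F (a, b) ∂μ (Fin.last k) ∂Measure.pi fun i : Fin k => μ i.castSucc := by
  rw [← lintegral_prod _ hF.aemeasurable, ← (measurePreserving_piFinSnoc μ).lintegral_comp hF]
  rfl

theorem MeasureTheory.lintegral_fin_prod {k : ℕ} {α : Fin k → Type*}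
    [∀ i, MeasurableSpace (α i)] (μ : ∀ i, Measure (α i)) [∀ i, SigmaFinite (μ i)]
    (F : ∀ i, α i → ℝ≥0∞) (hF : ∀ i, Measurable (F i)) :
    ∫⁻ x, ∏ i, F i (x i) ∂Measure.pi μ = ∏ i, ∫⁻ y, F i y ∂μ i := by
  induction k with
  | zero => simp
  | succ k ih =>
    simp only [Fin.prod_univ_castSucc]
    have hm : Measurable fun a : ∀ i : Fin k, α i.castSucc => ∏ i, F i.castSucc (a i) :=
      Finset.measurable_prod _ fun i _ => (hF _).comp (measurable_pi_apply i)
    rw [lintegral_pi_finSnoc μ (fun p => (∏ i : Fin k, F i.castSucc (p.1 i)) * F (Fin.last k) p.2)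
      ((hm.comp measurable_fst).mul ((hF _).comp measurable_snd)),
      ← ih (fun i => μ i.castSucc) (fun i => F i.castSucc) fun i => hF _]
    simp_rw [lintegral_const_mul _ (hF (Fin.last k))]
    rw [lintegral_mul_const _ hm]

/-! ### Factorization of the laws over the last group. -/

namespace GroupSequentialModel

variable {X : Type*} [MeasurableSpace X] (M : GroupSequentialModel X)

@[fun_prop]
theorem measurable_jointDensity (i : Fin 2) {k : ℕ} (n : Fin k → M.G) :
    Measurable (M.jointDensity i n) :=
  Finset.measurable_prod _ fun l _ => Finset.measurable_prod _ fun j _ =>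
    (M.measurable_f i).comp ((measurable_pi_apply j).comp (measurable_pi_apply l))

theorem measurable_ratio {k : ℕ} (n : Fin k → M.G) : Measurable (M.ratio n) :=
  (M.measurable_jointDensity 1 n).coe_nnreal_ennreal.div
    (M.measurable_jointDensity 0 n).coe_nnreal_ennreal

instance {k : ℕ} (n : Fin k → M.G) : SigmaFinite (M.dataMeasure n) := by
  unfold dataMeasure; infer_instance

theorem expect_eq_lintegral (i : Fin 2) {k : ℕ} (n : Fin k → M.G) (F : M.Data n → ℝ≥0∞) :
    M.expect i n F = ∫⁻ x, M.jointDensity i n x * F x ∂M.dataMeasure n := by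
  unfold expect law
  rw [lintegral_withDensity_eq_lintegral_mul_non_measurable _
    (M.measurable_jointDensity i n).coe_nnreal_ennreal (ae_of_all _ fun x => ENNReal.coe_lt_top)]
  rfl

instance isProbabilityMeasure_law (i : Fin 2) {k : ℕ} (n : Fin k → M.G) :
    IsProbabilityMeasure (M.law i n) := by
  constructor
  rw [law, withDensity_apply _ MeasurableSet.univ, Measure.restrict_univ, dataMeasure]
  simp only [jointDensity, ENNReal.ofNNReal_finsetProd]
  have h (m : M.G) (_ : Fin (m : ℕ)) : Measurable fun x => (M.f i x : ℝ≥0∞) :=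
    (M.measurable_f i).coe_nnreal_ennreal
  rw [lintegral_fin_prod (fun l => Measure.pi fun _ : Fin (n l : ℕ) => M.μ)
    (fun l (y : Fin (n l : ℕ) → X) => ∏ j, (M.f i (y j) : ℝ≥0∞))
    fun l => Finset.measurable_prod _ fun j _ => (h (n l) j).comp (measurable_pi_apply j)]
  refine Finset.prod_eq_one fun l _ => ?_
  rw [lintegral_fin_prod (fun _ => M.μ) (fun _ x => (M.f i x : ℝ≥0∞)) (h (n l))]
  simp [M.lintegral_f]

theorem expect_const (i : Fin 2) {k : ℕ} (n : Fin k → M.G) (a : ℝ≥0∞) :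
    M.expect i n (fun _ => a) = a := by
  simp [expect]

theorem ae_law_iff (i : Fin 2) {k : ℕ} (n : Fin k → M.G) (P : M.Data n → Prop) :
    (∀ᵐ x ∂M.law i n, P x) ↔ ∀ᵐ x ∂M.dataMeasure n, M.jointDensity i n x ≠ 0 → P x := by
  rw [law, ae_withDensity_iff (M.measurable_jointDensity i n).coe_nnreal_ennreal]
  simp

theorem jointDensity_castSucc (i : Fin 2) {k : ℕ} (n : Fin (k + 1) → M.G) (x : M.Data n) :
    M.jointDensity i n x =
      M.jointDensity i (fun l : Fin k => n l.castSucc) (fun l => x l.castSucc) *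
        M.jointDensity i (fun _ : Fin 1 => n (Fin.last k)) (fun _ => x (Fin.last k)) := by
  simp [jointDensity, Fin.prod_univ_castSucc]

/-- Fubini together with the product form of the density. The last group is treated as a one-group
sample, the form in which it enters `nextMean`. -/
theorem expect_castSucc (i : Fin 2) {k : ℕ} (n : Fin (k + 1) → M.G)
    (F : M.Data (fun l : Fin k => n l.castSucc) →
      M.Data (fun _ : Fin 1 => n (Fin.last k)) → ℝ≥0∞)
    (hF : Measurable (Function.uncurry F)) :
    M.expect i n (fun x => F (fun l => x l.castSucc) fun _ => x (Fin.last k)) =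
      M.expect i (fun l : Fin k => n l.castSucc) fun a =>
        M.expect i (fun _ : Fin 1 => n (Fin.last k)) fun b => F a b := by
  have hc : Measurable fun (y : Fin (n (Fin.last k) : ℕ) → X) =>
      ((fun _ => y) : M.Data (fun _ : Fin 1 => n (Fin.last k))) :=
    measurable_pi_iff.2 fun _ => measurable_id
  have hG : Measurable fun p : M.Data (fun l : Fin k => n l.castSucc) ×
      M.Data (fun _ : Fin 1 => n (Fin.last k)) =>
      (M.jointDensity i (fun l : Fin k => n l.castSucc) p.1 : ℝ≥0∞) *
        (M.jointDensity i (fun _ : Fin 1 => n (Fin.last k)) p.2 * F p.1 p.2) :=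
    ((M.measurable_jointDensity _ _).comp measurable_fst).coe_nnreal_ennreal.mul
      (((M.measurable_jointDensity _ _).comp measurable_snd).coe_nnreal_ennreal.mul hF)
  simp only [expect_eq_lintegral, M.jointDensity_castSucc i n, ENNReal.coe_mul, mul_assoc]
  refine (lintegral_pi_finSnoc (fun l => Measure.pi fun _ : Fin (n l : ℕ) => M.μ)
    _ (hG.comp (measurable_fst.prodMk (hc.comp measurable_snd)))).trans ?_
  refine lintegral_congr fun a => ?_
  have hGa := hG.comp (measurable_prodMk_left (x := a))
  refine Eq.trans ?_ (lintegral_const_mul (μ := M.dataMeasure fun _ : Fin 1 => n (Fin.last k)) _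
    (((M.measurable_jointDensity i _).coe_nnreal_ennreal).mul (hF.comp measurable_prodMk_left)))
  refine ((measurePreserving_piUnique
    (fun _ : Fin 1 => Measure.pi fun _ : Fin (n (Fin.last k) : ℕ) => M.μ)).lintegral_comp
      (hGa.comp hc)).symm.trans ?_
  refine lintegral_congr fun b => ?_
  have : (fun _ => b 0 : M.Data (fun _ : Fin 1 => n (Fin.last k))) = b := by
    funext j; rw [Subsingleton.elim j 0]
  exact congrArg (fun b' => (M.jointDensity i (fun l : Fin k => n l.castSucc) a : ℝ≥0∞) *
        (M.jointDensity i (fun _ : Fin 1 => n (Fin.last k)) b' * F a b')) this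

/-! ### Value functions and the Bellman equation. -/

theorem measurable_g (lam₀ lam₁ : ℝ≥0) : Measurable (g lam₀ lam₁) :=
  measurable_const.min (measurable_id.const_mul _)

theorem measurable_nextMean (k : ℕ) {V : ℝ≥0∞ → ℝ≥0∞} (hV : Measurable V) :
    Measurable (M.nextMean k V) := by
  refine Measurable.tsum fun m => Measurable.const_mul ?_ _
  exact Measurable.lintegral_prod_right' (f := fun q : ℝ≥0∞ × M.Data (fun _ : Fin 1 => m) =>
    V (q.1 * M.ratio (fun _ : Fin 1 => m) q.2))
    (hV.comp (measurable_fst.mul ((M.measurable_ratio _).comp measurable_snd)))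

theorem measurable_truncV (lam₀ lam₁ : ℝ≥0) (r k : ℕ) : Measurable (M.truncV lam₀ lam₁ r k) := by
  induction r generalizing k with
  | zero => exact measurable_g lam₀ lam₁
  | succ r ih => exact (measurable_g lam₀ lam₁).min ((M.measurable_nextMean _ (ih _)).const_add _)

theorem measurable_V (lam₀ lam₁ : ℝ≥0) (k : ℕ) : Measurable (M.V lam₀ lam₁ k) :=
  measurable_of_tendsto_metrizable (fun r => M.measurable_truncV lam₀ lam₁ r k)
    (tendsto_pi_nhds.2 fun z => M.tendsto_truncV lam₀ lam₁ k z)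

theorem truncV_le (lam₀ lam₁ : ℝ≥0) (r k : ℕ) (z : ℝ≥0∞) : M.truncV lam₀ lam₁ r k z ≤ lam₀ :=
  (M.truncV_antitone lam₀ lam₁ k z (Nat.zero_le r)).trans (min_le_left _ _)

theorem V_le (lam₀ lam₁ : ℝ≥0) (k : ℕ) (z : ℝ≥0∞) : M.V lam₀ lam₁ k z ≤ lam₀ :=
  le_of_tendsto' (M.tendsto_truncV lam₀ lam₁ k z) fun r => M.truncV_le lam₀ lam₁ r k z

/-- Dominated convergence twice: over the group sizes, where the sum is an integral for counting
measure dominated by `p_k C`, and under the law of the group, dominated by `C`. -/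
theorem tendsto_nextMean (k : ℕ) {F : ℕ → ℝ≥0∞ → ℝ≥0∞} {f : ℝ≥0∞ → ℝ≥0∞} {C : ℝ≥0}
    (hF : ∀ r, Measurable (F r)) (hC : ∀ r z, F r z ≤ C)
    (h : ∀ z, Tendsto (fun r => F r z) atTop (nhds (f z))) (z : ℝ≥0∞) :
    Tendsto (fun r => M.nextMean k (F r) z) atTop (nhds (M.nextMean k f z)) := by
  simp only [nextMean, ← lintegral_count]
  refine tendsto_lintegral_of_dominated_convergence (fun m => M.p k m * C)
    (fun r => measurable_of_countable _) (fun r => ae_of_all _ fun m => ?_) ?_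
    (ae_of_all _ fun m => ?_)
  · refine mul_le_mul_right ?_ _
    exact (lintegral_mono fun x => hC r _).trans (M.expect_const 0 _ _).le
  · rw [lintegral_count, ENNReal.tsum_mul_right, PMF.tsum_coe, one_mul]
    exact ENNReal.coe_ne_top
  · refine ENNReal.Tendsto.const_mul ?_ (Or.inr ((M.p k).apply_ne_top m))
    refine tendsto_lintegral_of_dominated_convergence (fun _ => C)
      (fun r => (hF r).comp ((M.measurable_ratio _).const_mul z))
      (fun r => ae_of_all _ fun x => hC r _) ?_ (ae_of_all _ fun x => h _)
    simp

/-- The Bellman equation of the limiting value functions. -/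
theorem V_eq (lam₀ lam₁ : ℝ≥0) (k : ℕ) (z : ℝ≥0∞) :
    M.V lam₀ lam₁ k z =
      min (g lam₀ lam₁ z) (M.avgCost (k + 1) + M.Vbar lam₀ lam₁ (k + 1) z) := by
  refine tendsto_nhds_unique ((tendsto_add_atTop_iff_nat 1).2 (M.tendsto_truncV lam₀ lam₁ k z)) ?_
  exact tendsto_const_nhds.min (tendsto_const_nhds.add (M.tendsto_nextMean (k + 1)
    (fun r => M.measurable_truncV lam₀ lam₁ r (k + 1))
    (fun r z => M.truncV_le lam₀ lam₁ r (k + 1) z)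
    (fun z => M.tendsto_truncV lam₀ lam₁ (k + 1) z) z))

/-! ### Averages over group sizes and data. -/

/-- `∑_n p(n) E_i F_n`, the sum running over the possible sizes of the first `k` groups. -/
noncomputable def mean (i : Fin 2) {k : ℕ} (F : ∀ n : Fin k → M.G, M.Data n → ℝ≥0∞) : ℝ≥0∞ :=
  ∑' n : Fin k → M.G, M.sizeProb n * M.expect i n (F n)

section mean

variable {M} {i : Fin 2} {k : ℕ} {F F' : ∀ n : Fin k → M.G, M.Data n → ℝ≥0∞}

theorem mean_congr_ae (h : ∀ n, 0 < M.sizeProb n → ∀ᵐ x ∂M.law i n, F n x = F' n x) :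
    M.mean i F = M.mean i F' := by
  refine tsum_congr fun n => ?_
  rcases eq_or_ne (M.sizeProb n) 0 with h0 | h0
  · simp [h0]
  · rw [expect, expect, lintegral_congr_ae (h n (pos_iff_ne_zero.2 h0))]

theorem mean_mono (h : ∀ n x, F n x ≤ F' n x) : M.mean i F ≤ M.mean i F' :=
  ENNReal.tsum_le_tsum fun n => mul_le_mul_right (lintegral_mono fun x => h n x) _

theorem mean_add (hF : ∀ n, Measurable (F n)) :
    M.mean i (fun n x => F n x + F' n x) = M.mean i F + M.mean i F' := by
  simp only [mean, expect, lintegral_add_left (hF _), mul_add, ENNReal.tsum_add]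

theorem mean_const_mul (a : ℝ≥0∞) (hF : ∀ n, Measurable (F n)) :
    M.mean i (fun n x => a * F n x) = a * M.mean i F := by
  simp only [mean, expect, lintegral_const_mul _ (hF _), mul_left_comm _ a, ENNReal.tsum_mul_left]

theorem mean_eq_zero_iff (hF : ∀ n, Measurable (F n)) :
    M.mean i F = 0 ↔ ∀ n, 0 < M.sizeProb n → ∀ᵐ x ∂M.law i n, F n x = 0 := by
  simp only [mean, ENNReal.tsum_eq_zero, mul_eq_zero, expect, lintegral_eq_zero_iff (hF _),
    pos_iff_ne_zero, ← or_iff_not_imp_left]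
  rfl

end mean

theorem sizeProb_castSucc {k : ℕ} (n : Fin (k + 1) → M.G) :
    M.sizeProb n = M.sizeProb (fun l : Fin k => n l.castSucc) * M.p (k + 1) (n (Fin.last k)) := by
  simp [sizeProb, Fin.prod_univ_castSucc]

theorem cost_castSucc {k : ℕ} (n : Fin (k + 1) → M.G) :
    M.cost n = M.cost (fun l : Fin k => n l.castSucc) + M.c (n (Fin.last k)) := by
  simp [cost, Fin.sum_univ_castSucc]

theorem cost_lt_top {k : ℕ} (n : Fin k → M.G) : M.cost n < ∞ := by
  simp [cost, ENNReal.sum_lt_top]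

theorem ratio_castSucc_ae {k : ℕ} (n : Fin (k + 1) → M.G) :
    ∀ᵐ x ∂M.law 0 n, M.ratio n x = M.ratio (fun l : Fin k => n l.castSucc) (fun l => x l.castSucc) *
        M.ratio (fun _ : Fin 1 => n (Fin.last k)) (fun _ => x (Fin.last k)) := by
  rw [ae_law_iff]
  refine ae_of_all _ fun x hx => ?_
  rw [M.jointDensity_castSucc, mul_ne_zero_iff] at hx
  simp only [ratio, M.jointDensity_castSucc _ n x, ENNReal.coe_mul]
  -- Both factors of the `H₀` density are nonzero, so all ratios are finite and the identity is one
  -- in `ℝ≥0`.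
  rw [← ENNReal.coe_div hx.1, ← ENNReal.coe_div hx.2, ← ENNReal.coe_mul, ← ENNReal.coe_mul,
    ← ENNReal.coe_div (mul_ne_zero hx.1 hx.2), ← ENNReal.coe_mul, mul_div_mul_comm]

theorem mean_castSucc (i : Fin 2) {k : ℕ}
    (F : ∀ (n : Fin k → M.G) (m : M.G), M.Data n → M.Data (fun _ : Fin 1 => m) → ℝ≥0∞)
    (hF : ∀ n m, Measurable (Function.uncurry (F n m))) :
    M.mean i (k := k + 1) (fun n x => F (fun l => n l.castSucc) (n (Fin.last k))
        (fun l => x l.castSucc) fun _ => x (Fin.last k)) =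
      M.mean i (fun n a => ∑' m, M.p (k + 1) m * M.expect i (fun _ : Fin 1 => m) (F n m a)) := by
  have hm (n : Fin k → M.G) (m : M.G) :
      Measurable fun a => M.expect i (fun _ : Fin 1 => m) (F n m a) :=
    Measurable.lintegral_prod_right' (hF n m)
  -- Hiding the integrals behind `J` removes the dependence of the data type on `n`, so that the
  -- sizes can be rewritten along `Fin.snocEquiv`.
  obtain ⟨J, hJ⟩ : ∃ J : (Fin k → M.G) → M.G → ℝ≥0∞, ∀ n m, M.expect i n (fun a =>
      M.expect i (fun _ : Fin 1 => m) (F n m a)) = J n m := ⟨_, fun _ _ => rfl⟩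
  have h (n : Fin (k + 1) → M.G) := (M.expect_castSucc i n _ (hF (fun l => n l.castSucc)
    (n (Fin.last k)))).trans (hJ _ _)
  simp only [mean, h, M.sizeProb_castSucc]
  rw [← (Fin.snocEquiv fun _ => M.G).tsum_eq, ENNReal.tsum_prod', ENNReal.tsum_comm]
  refine tsum_congr fun n => ?_
  simp only [Fin.snocEquiv_apply, Fin.snoc_castSucc, Fin.snoc_last, mul_assoc,
    ENNReal.tsum_mul_left]
  congr 1
  rw [expect, lintegral_tsum fun m => ((hm n m).const_mul _).aemeasurable]
  refine tsum_congr fun m => ?_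
  rw [lintegral_const_mul _ (hm n m), ← hJ, expect]

/-! ### Conditioning on all groups but the last. -/

section Rule

variable {M} (ψ : M.Rule)

theorem Rule.measurable_t {k : ℕ} (n : Fin (k + 1) → M.G) : Measurable (ψ.t n) :=
  Finset.measurable_prod _ fun _ _ => measurable_const.sub
    ((ψ.measurable_toFun _).comp (measurable_pi_iff.2 fun _ => measurable_pi_apply _))

theorem Rule.measurable_s {k : ℕ} (n : Fin (k + 1) → M.G) : Measurable (ψ.s n) :=
  (ψ.measurable_t n).mul (ψ.measurable_toFun n)

theorem Rule.t_one (n : Fin 1 → M.G) (x : M.Data n) : ψ.t n x = 1 := by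
  simp [Rule.t]

theorem Rule.t_castSucc {k : ℕ} (n : Fin (k + 2) → M.G) (x : M.Data n) :
    ψ.t n x = ψ.t (fun l : Fin (k + 1) => n l.castSucc) (fun l => x l.castSucc) *
      (1 - ψ (fun l : Fin (k + 1) => n l.castSucc) (fun l => x l.castSucc)) := by
  simp only [Rule.t]
  rw [Fin.prod_univ_castSucc]
  rfl

theorem mean_t_succ {k : ℕ} (w : (Fin (k + 1) → M.G) → ℝ≥0∞) :
    M.mean 0 (fun (n : Fin (k + 2) → M.G) x => ψ.t n x * w (fun l => n l.castSucc)) =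
      M.mean 0 (fun (n : Fin (k + 1) → M.G) x => ψ.t n x * (1 - ψ n x) * w n) := by
  simp only [ψ.t_castSucc]
  rw [M.mean_castSucc 0 (fun (n : Fin (k + 1) → M.G) m a b => ψ.t n a * (1 - ψ n a) * w n)]
  · simp [expect_const, ENNReal.tsum_mul_right, PMF.tsum_coe]
  · exact fun n m => ((((ψ.measurable_t n).mul
      (measurable_const.sub (ψ.measurable_toFun n))).mul_const _).comp measurable_fst)

/-- Given the past, the factor `t` is fixed, the new group adds `c̄` to the cost on average, and `W`
of the updated ratio averages to `nextMean`. -/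
theorem mean_t_cost_add_succ {k : ℕ} {W : ℝ≥0∞ → ℝ≥0∞} (hW : Measurable W) :
    M.mean 0 (fun (n : Fin (k + 2) → M.G) x => ψ.t n x * (M.cost n + W (M.ratio n x))) =
      M.mean 0 (fun (n : Fin (k + 1) → M.G) x => ψ.t n x * (1 - ψ n x) *
        (M.cost n + (M.avgCost (k + 2) + M.nextMean (k + 2) W (M.ratio n x)))) := by
  have h1 : M.mean 0 (fun (n : Fin (k + 2) → M.G) x => ψ.t n x * (M.cost n + W (M.ratio n x))) =
      M.mean 0 (fun (n : Fin (k + 2) → M.G) x =>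
        ψ.t (fun l : Fin (k + 1) => n l.castSucc) (fun l => x l.castSucc) *
        (1 - ψ (fun l : Fin (k + 1) => n l.castSucc) (fun l => x l.castSucc)) *
        (M.cost (fun l : Fin (k + 1) => n l.castSucc) + M.c (n (Fin.last (k + 1))) +
          W (M.ratio (fun l : Fin (k + 1) => n l.castSucc) (fun l => x l.castSucc) *
            M.ratio (fun _ : Fin 1 => n (Fin.last (k + 1))) (fun _ => x (Fin.last (k + 1)))))) := by
    refine mean_congr_ae fun n _ => ?_
    filter_upwards [M.ratio_castSucc_ae n] with x hx
    rw [hx, ψ.t_castSucc, M.cost_castSucc]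
  have hmW (z : ℝ≥0∞) (m : M.G) :
      Measurable fun b => W (z * M.ratio (fun _ : Fin 1 => m) b) :=
    hW.comp ((M.measurable_ratio _).const_mul z)
  rw [h1, M.mean_castSucc 0 (fun (n : Fin (k + 1) → M.G) m a b => ψ.t n a * (1 - ψ n a) *
    (M.cost n + M.c m + W (M.ratio n a * M.ratio (fun _ : Fin 1 => m) b)))]
  · congr 1
    funext n a
    have h2 (m : M.G) : M.expect 0 (fun _ : Fin 1 => m) (fun b => ψ.t n a * (1 - ψ n a) *
        (M.cost n + M.c m + W (M.ratio n a * M.ratio (fun _ : Fin 1 => m) b))) =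
        ψ.t n a * (1 - ψ n a) * (M.cost n + (M.c m + M.expect 0 (fun _ : Fin 1 => m)
          fun b => W (M.ratio n a * M.ratio (fun _ : Fin 1 => m) b))) := by
      rw [expect, lintegral_const_mul _ ((hmW _ m).const_add _),
        lintegral_add_left measurable_const, lintegral_const, measure_univ, mul_one, add_assoc]
      rfl
    simp only [h2, mul_left_comm _ (ψ.t n a * (1 - ψ n a)), ENNReal.tsum_mul_left]
    simp only [mul_add, ENNReal.tsum_add, ENNReal.tsum_mul_right, PMF.tsum_coe, one_mul]
    rfl
  · intro n m
    exact (((ψ.measurable_t n).mul (measurable_const.sub (ψ.measurable_toFun n))).comp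
      measurable_fst).mul (measurable_const.add (hW.comp
        (((M.measurable_ratio n).comp measurable_fst).mul
          ((M.measurable_ratio _).comp measurable_snd))))

end Rule

end GroupSequentialModel

/-! ### Excess loss of a randomized choice, and of the terminal decision. -/

namespace GroupSequentialModel

variable {X : Type*} [MeasurableSpace X] {M : GroupSequentialModel X}

/-- The excess of the mixture of two values over the smaller one. -/
theorem mixture_add_excess {t a c v d e : ℝ≥0∞} (ha : a ≤ 1) (hd : v ≤ d) (he : v ≤ e) :
    t * (c + v) + t * (a * (d - v) + (1 - a) * (e - v)) =
      t * a * (c + d) + t * (1 - a) * (c + e) := by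
  have h1 : a + (1 - a) = 1 := add_tsub_cancel_of_le ha
  have h2 : v + (d - v) = d := add_tsub_cancel_of_le hd
  have h3 : v + (e - v) = e := add_tsub_cancel_of_le he
  -- Once the truncated differences are variables, the claim is a semiring identity.
  generalize d - v = d' at *
  generalize e - v = e' at *
  generalize 1 - a = b at *
  subst h2 h3
  calc _ = t * (c + v) * (a + b) + t * (a * d' + b * e') := by rw [h1, mul_one]
    _ = _ := by ring

/-- The excess forces `a = 1` if `d < e`, `a = 0` if `e < d`, and nothing on a tie, which is exactly
the meaning of `≃`. -/
theorem excess_eq_zero_iff {t a d e : ℝ≥0∞} (ha : a ≤ 1) :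
    t * (a * (d - min d e) + (1 - a) * (e - min d e)) = 0 ↔ (0 < t → IsIndicatorLE a d e) := by
  rw [mul_eq_zero, pos_iff_ne_zero, or_iff_not_imp_left]
  refine imp_congr_right fun _ => ?_
  simp only [add_eq_zero, mul_eq_zero, tsub_eq_zero_iff_le, le_min_iff, le_refl, true_and, and_true,
    IsIndicatorLE]
  rcases lt_trichotomy d e with h | h | h
  · simpa [h, h.le, h.not_ge] using fun _ => ha
  · simpa [h] using ha
  · simp [h.not_ge, h.le, h.not_gt]

section Decision

theorem coe_mul_g_div (lam₀ lam₁ a b : ℝ≥0) :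
    (a : ℝ≥0∞) * g lam₀ lam₁ ((b : ℝ≥0∞) / a) = min ((lam₀ : ℝ≥0∞) * a) (lam₁ * b) := by
  rcases eq_or_ne a 0 with rfl | ha
  · simp
  · rw [g, ← ENNReal.coe_div ha]
    norm_cast
    rw [mul_min, mul_comm a, mul_left_comm, mul_div_cancel₀ _ ha]

/-- Cross-multiplication. The case `a = b = 0` must be excluded: the ratio is then `0` by
convention, whereas comparing `0` with `0` leaves `u` free. -/
theorem isIndicatorLE_div_iff {lam₀ lam₁ a b : ℝ≥0} (h₁ : 0 < lam₁)
    (hab : a ≠ 0 ∨ b ≠ 0) (u : ℝ≥0∞) :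
    IsIndicatorLE u ((lam₀ : ℝ≥0∞) / lam₁) ((b : ℝ≥0∞) / a) ↔
      IsIndicatorLE u ((lam₀ : ℝ≥0∞) * a) (lam₁ * b) := by
  rcases eq_or_ne a 0 with rfl | ha
  · have hb : 0 < b := pos_iff_ne_zero.2 (by simpa using hab)
    have h2 : (lam₀ : ℝ≥0∞) / lam₁ < ∞ := ENNReal.div_lt_top (by simp) (by simpa using h₁.ne')
    simp [IsIndicatorLE, ENNReal.div_zero, hb.ne', h₁, hb, h2]
  · rw [← ENNReal.coe_div ha, ← ENNReal.coe_div h₁.ne']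
    have ha' := pos_iff_ne_zero.2 ha
    simp only [IsIndicatorLE]
    norm_cast
    simp only [div_lt_div_iff₀ h₁ ha', div_le_div_iff₀ h₁ ha', mul_comm b]

variable (M) in
/-- The expected excess of the loss caused by the decision after the last group in `n`, over the
loss of the Bayes decision. -/
noncomputable def decisionExcess (lam₀ lam₁ : ℝ≥0) (ψ φ : M.Rule) {k : ℕ} (n : Fin (k + 1) → M.G) :
    ℝ≥0∞ :=
  ∫⁻ x, ψ.s n x *
    (φ n x * ((lam₀ : ℝ≥0∞) * M.jointDensity 0 n x -
        min ((lam₀ : ℝ≥0∞) * M.jointDensity 0 n x) (lam₁ * M.jointDensity 1 n x)) +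
      (1 - φ n x) * ((lam₁ : ℝ≥0∞) * M.jointDensity 1 n x -
        min ((lam₀ : ℝ≥0∞) * M.jointDensity 0 n x) (lam₁ * M.jointDensity 1 n x)))
    ∂M.dataMeasure n

variable {lam₀ lam₁ : ℝ≥0} {ψ φ : M.Rule}

/-- Everything is integrated against `μ^n`, since the type II error also charges points where `f₀`
vanishes. There `φ` mixes the losses `λ₀ f₀` and `λ₁ f₁`. -/
theorem expect_g_add_decisionExcess {k : ℕ} (n : Fin (k + 1) → M.G) :
    M.expect 0 n (fun x => ψ.s n x * g lam₀ lam₁ (M.ratio n x)) +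
        M.decisionExcess lam₀ lam₁ ψ φ n =
      lam₀ * M.expect 0 n (fun x => ψ.s n x * φ n x) +
        lam₁ * M.expect 1 n (fun x => ψ.s n x * (1 - φ n x)) := by
  have hs := ψ.measurable_s n
  have hφ := φ.measurable_toFun n
  have hφ' : Measurable fun x => 1 - φ n x := measurable_const.sub hφ
  have hf (i : Fin 2) : Measurable fun x => (M.jointDensity i n x : ℝ≥0∞) :=
    (M.measurable_jointDensity i n).coe_nnreal_ennreal
  have hg : Measurable fun x => g lam₀ lam₁ (M.ratio n x) :=
    (measurable_g _ _).comp (M.measurable_ratio n)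
  simp only [expect_eq_lintegral, decisionExcess]
  rw [← lintegral_const_mul _ (by fun_prop), ← lintegral_const_mul _ (by fun_prop),
    ← lintegral_add_left (by fun_prop), ← lintegral_add_left (by fun_prop)]
  refine lintegral_congr fun x => ?_
  have h := mixture_add_excess (t := ψ.s n x) (c := 0) (φ.le_one n x)
    (min_le_left ((lam₀ : ℝ≥0∞) * M.jointDensity 0 n x) (lam₁ * M.jointDensity 1 n x))
    (min_le_right _ _)
  simp only [zero_add] at h
  rw [mul_left_comm, ratio, coe_mul_g_div, h]
  ring

theorem measurable_decisionExcess_integrand {k : ℕ} (n : Fin (k + 1) → M.G) :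
    Measurable fun x => ψ.s n x *
    (φ n x * ((lam₀ : ℝ≥0∞) * M.jointDensity 0 n x -
        min ((lam₀ : ℝ≥0∞) * M.jointDensity 0 n x) (lam₁ * M.jointDensity 1 n x)) +
      (1 - φ n x) * ((lam₁ : ℝ≥0∞) * M.jointDensity 1 n x -
        min ((lam₀ : ℝ≥0∞) * M.jointDensity 0 n x) (lam₁ * M.jointDensity 1 n x))) := by
  have hs := ψ.measurable_s n
  have hφ := φ.measurable_toFun n
  have hf (i : Fin 2) : Measurable fun x => (M.jointDensity i n x : ℝ≥0∞) :=
    (M.measurable_jointDensity i n).coe_nnreal_ennreal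
  fun_prop

theorem conditionD_iff (h₁ : 0 < lam₁) :
    M.ConditionD lam₀ lam₁ ψ φ ↔
      ∑' k : ℕ, ∑' n : Fin (k + 1) → M.G, M.sizeProb n * M.decisionExcess lam₀ lam₁ ψ φ n = 0 := by
  simp only [ConditionD, ENNReal.tsum_eq_zero, mul_eq_zero, ae_law_iff]
  refine forall_congr' fun k => forall_congr' fun n => ?_
  rw [or_iff_not_imp_left, ← ne_eq, ← pos_iff_ne_zero, decisionExcess,
    lintegral_eq_zero_iff (measurable_decisionExcess_integrand n), ← ae_all_iff]
  refine imp_congr_right fun _ => eventually_congr (ae_of_all _ fun x => ?_)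
  rw [Pi.zero_apply, excess_eq_zero_iff (φ.le_one n x), Fin.forall_fin_two, ratio]
  rcases em (M.jointDensity 0 n x ≠ 0 ∨ M.jointDensity 1 n x ≠ 0) with h | h
  · rw [isIndicatorLE_div_iff h₁ h]
    tauto
  -- Where both densities vanish, neither law sees the point and the excess is zero for any `φ`.
  · push Not at h
    simp [h.1, h.2, IsIndicatorLE, φ.le_one]

end Decision

/-! ### Excess loss of stopping, and telescoping of the Bellman equation. -/

section Stopping

variable {lam₀ lam₁ : ℝ≥0} {ψ : M.Rule}

variable (M) in
/-- The excess of the loss caused by the stopping rule after the last group in `n`, over the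
loss of the optimal choice between stopping and continuation. -/
noncomputable def stoppingExcess (lam₀ lam₁ : ℝ≥0) (ψ : M.Rule) {k : ℕ} (n : Fin (k + 1) → M.G)
    (x : M.Data n) : ℝ≥0∞ :=
  ψ.t n x * (ψ n x * (g lam₀ lam₁ (M.ratio n x) - M.V lam₀ lam₁ (k + 1) (M.ratio n x)) +
    (1 - ψ n x) * (M.avgCost (k + 2) + M.Vbar lam₀ lam₁ (k + 2) (M.ratio n x) -
      M.V lam₀ lam₁ (k + 1) (M.ratio n x)))

theorem measurable_stoppingExcess {k : ℕ} (n : Fin (k + 1) → M.G) :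
    Measurable (M.stoppingExcess lam₀ lam₁ ψ n) := by
  have ht := ψ.measurable_t n
  have hψ := ψ.measurable_toFun n
  have hr := M.measurable_ratio n
  have hg := (measurable_g lam₀ lam₁).comp hr
  have hV := (M.measurable_V lam₀ lam₁ (k + 1)).comp hr
  have hVb := (M.measurable_nextMean (k + 2) (M.measurable_V lam₀ lam₁ (k + 2))).comp hr
  exact ht.mul ((hψ.mul (hg.sub hV)).add
    ((measurable_const.sub hψ).mul ((hVb.const_add _).sub hV)))

theorem conditionS_iff :
    M.ConditionS lam₀ lam₁ ψ ↔
      ∑' k : ℕ, M.mean 0 (fun (n : Fin (k + 1) → M.G) => M.stoppingExcess lam₀ lam₁ ψ n) = 0 := by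
  simp only [ENNReal.tsum_eq_zero, mean_eq_zero_iff measurable_stoppingExcess, ConditionS,
    stoppingExcess, V_eq, excess_eq_zero_iff (ψ.le_one _ _)]

theorem mean_t_add_stoppingExcess (k : ℕ) :
    M.mean 0 (fun (n : Fin (k + 1) → M.G) x =>
        ψ.t n x * (M.cost n + M.V lam₀ lam₁ (k + 1) (M.ratio n x))) +
      M.mean 0 (fun (n : Fin (k + 1) → M.G) => M.stoppingExcess lam₀ lam₁ ψ n) =
    M.mean 0 (fun (n : Fin (k + 1) → M.G) x =>
        ψ.s n x * (M.cost n + g lam₀ lam₁ (M.ratio n x))) +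
      M.mean 0 (fun (n : Fin (k + 2) → M.G) x =>
        ψ.t n x * (M.cost n + M.V lam₀ lam₁ (k + 2) (M.ratio n x))) := by
  rw [mean_t_cost_add_succ ψ (M.measurable_V _ _ _), ← mean_add, ← mean_add]
  · congr 1
    funext n x
    exact mixture_add_excess (ψ.le_one n x) ((M.V_eq _ _ _ _).trans_le (min_le_left _ _))
      ((M.V_eq _ _ _ _).trans_le (min_le_right _ _))
  · exact fun n => (ψ.measurable_s n).mul
      (((measurable_g _ _).comp (M.measurable_ratio n)).const_add _)
  · exact fun n => (ψ.measurable_t n).mul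
      (((M.measurable_V _ _ _).comp (M.measurable_ratio n)).const_add _)

variable (M) in
/-- The value of the optimal stopping problem. -/
noncomputable def initialValue (lam₀ lam₁ : ℝ≥0) : ℝ≥0∞ :=
  M.mean 0 (fun (n : Fin 1 → M.G) x => M.cost n + M.V lam₀ lam₁ 1 (M.ratio n x))

/-- Since `V ≤ λ₀`, the value is at most `c̄₁ + λ₀`. -/
theorem initialValue_ne_top : M.initialValue lam₀ lam₁ ≠ ∞ := by
  refine ne_top_of_le_ne_top ?_ (mean_mono fun n x => add_le_add_right (M.V_le _ _ _ _) _)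
  simp only [M.cost_castSucc]
  rw [M.mean_castSucc 0 (k := 0) (fun n m a b => M.cost n + M.c m + lam₀)
    fun _ _ => measurable_const]
  simp [expect_const, mean, sizeProb, cost, mul_add, ENNReal.tsum_add, ENNReal.tsum_mul_right,
    PMF.tsum_coe, (M.avgCost_lt_top 1 le_rfl).ne]

theorem initialValue_add_sum_stoppingExcess (N : ℕ) :
    M.initialValue lam₀ lam₁ + ∑ k ∈ Finset.range N,
        M.mean 0 (fun (n : Fin (k + 1) → M.G) => M.stoppingExcess lam₀ lam₁ ψ n) =
      ∑ k ∈ Finset.range N, M.mean 0 (fun (n : Fin (k + 1) → M.G) x =>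
        ψ.s n x * (M.cost n + g lam₀ lam₁ (M.ratio n x))) +
      M.mean 0 (fun (n : Fin (N + 1) → M.G) x =>
        ψ.t n x * (M.cost n + M.V lam₀ lam₁ (N + 1) (M.ratio n x))) := by
  induction N with
  | zero => simp [initialValue, ψ.t_one]
  | succ N ih =>
    rw [Finset.sum_range_succ, Finset.sum_range_succ, ← add_assoc, ih, add_assoc,
      mean_t_add_stoppingExcess, add_assoc]

/-! ### Vanishing of the remainder. -/

theorem mean_t_eq_add {k : ℕ} (w : (Fin (k + 1) → M.G) → ℝ≥0∞) :
    M.mean 0 (fun (n : Fin (k + 1) → M.G) x => ψ.t n x * w n) =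
      M.mean 0 (fun (n : Fin (k + 1) → M.G) x => ψ.s n x * w n) +
      M.mean 0 (fun (n : Fin (k + 2) → M.G) x => ψ.t n x * w (fun l => n l.castSucc)) := by
  rw [mean_t_succ, ← mean_add fun n => (ψ.measurable_s n).mul_const _]
  congr 1
  funext n x
  rw [Rule.s, ← add_mul, ← mul_add, add_tsub_cancel_of_le (ψ.le_one n x), mul_one]

/-- The probabilities of having stopped in the first `N` groups and of still running add up to one.
-/
theorem tendsto_mean_t (hψ : ψ ∈ M.terminating 0) :
    Tendsto (fun N => M.mean 0 (fun (n : Fin (N + 1) → M.G) => ψ.t n)) atTop (nhds 0) := by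
  have h1 (N : ℕ) : ∑ k ∈ Finset.range N, M.mean 0 (fun (n : Fin (k + 1) → M.G) => ψ.s n) +
      M.mean 0 (fun (n : Fin (N + 1) → M.G) => ψ.t n) = 1 := by
    induction N with
    | zero =>
      have h := M.mean_castSucc 0 (k := 0) (fun n m a b => 1) fun _ _ => measurable_const
      have h2 : M.mean 0 (fun (n : Fin 1 → M.G) => ψ.t n) =
        M.mean 0 (fun (n : Fin 1 → M.G) _ => 1) := by
        congr 1
      rw [Finset.sum_range_zero, zero_add, h2, h]
      simp [mean, expect_const, PMF.tsum_coe, sizeProb]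
    | succ N ih =>
      have h := mean_t_eq_add (ψ := ψ) (k := N) fun _ => 1
      simp only [mul_one] at h
      rw [Finset.sum_range_succ, add_assoc, ← h, ih]
  have h2 (N : ℕ) : M.mean 0 (fun (n : Fin (N + 1) → M.G) => ψ.t n) =
      1 - ∑ k ∈ Finset.range N, M.mean 0 (fun (n : Fin (k + 1) → M.G) => ψ.s n) := by
    refine ENNReal.eq_sub_of_add_eq ?_ ((add_comm _ _).trans (h1 N))
    exact ne_top_of_le_ne_top ENNReal.one_ne_top (le_self_add.trans (h1 N).le)
  have h3 : Tendsto (fun N => ∑ k ∈ Finset.range N,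
      M.mean 0 (fun (n : Fin (k + 1) → M.G) => ψ.s n)) atTop (nhds 1) := by
    have h := ENNReal.tendsto_nat_tsum fun k => M.mean 0 (fun (n : Fin (k + 1) → M.G) => ψ.s n)
    rwa [show ∑' k, M.mean 0 (fun (n : Fin (k + 1) → M.G) => ψ.s n) = 1 from hψ] at h
  simp only [h2]
  simpa using ENNReal.Tendsto.sub (tendsto_const_nhds (x := (1 : ℝ≥0∞))) h3
    (Or.inl ENNReal.one_ne_top)

theorem avgTotalCost_eq_tsum_mean (ψ : M.Rule) : M.avgTotalCost 0 ψ =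
    ∑' k : ℕ, M.mean 0 (fun (n : Fin (k + 1) → M.G) x => ψ.s n x * M.cost n) := by
  refine tsum_congr fun k => tsum_congr fun n => ?_
  rw [expect, expect, lintegral_mul_const _ (ψ.measurable_s n), mul_assoc, mul_comm (M.cost n)]

theorem le_sum_add_of_le_add_succ {a b : ℕ → ℝ≥0∞} (h : ∀ k, b k ≤ a k + b (k + 1)) (N L : ℕ) :
    b N ≤ ∑ k ∈ Finset.range L, a (k + N) + b (L + N) := by
  induction L with
  | zero => simp
  | succ L ih =>
    rw [Finset.sum_range_succ, add_assoc, Nat.add_right_comm]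
    exact ih.trans (add_le_add_right (h _) _)

/-- Costs only grow, so the cost at time `N` is dominated by the cost at the later stopping time.
Truncation at `R` bounds what is left after `L` more steps by `R` times a continuation probability,
which tends to zero. -/
theorem mean_t_min_cost_le (hψ : ψ ∈ M.terminating 0) (N : ℕ) (R : ℝ≥0) :
    M.mean 0 (fun (n : Fin (N + 1) → M.G) x => ψ.t n x * min (R : ℝ≥0∞) (M.cost n)) ≤
      ∑' k : ℕ, M.mean 0 (fun (n : Fin (k + N + 1) → M.G) x => ψ.s n x * M.cost n) := by
  have h1 := le_sum_add_of_le_add_succ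
    (a := fun k => M.mean 0 (fun (n : Fin (k + 1) → M.G) x => ψ.s n x * M.cost n))
    (b := fun k => M.mean 0 (fun (n : Fin (k + 1) → M.G) x => ψ.t n x * min (R : ℝ≥0∞) (M.cost n)))
    (fun k => by
      rw [mean_t_eq_add fun n => min (R : ℝ≥0∞) (M.cost n)]
      refine add_le_add (mean_mono fun n x => mul_le_mul_right (min_le_right _ _) _)
        (mean_mono fun n x => mul_le_mul_right (min_le_min le_rfl ?_) _)
      rw [M.cost_castSucc n]
      exact le_self_add) N
  have h2 (L : ℕ) :
      M.mean 0 (fun (n : Fin (N + 1) → M.G) x => ψ.t n x * min (R : ℝ≥0∞) (M.cost n)) ≤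
      ∑' k : ℕ, M.mean 0 (fun (n : Fin (k + N + 1) → M.G) x => ψ.s n x * M.cost n) +
      R * M.mean 0 (fun (n : Fin (L + N + 1) → M.G) => ψ.t n) := by
    refine (h1 L).trans (add_le_add (ENNReal.sum_le_tsum (f := fun k =>
      M.mean 0 (fun (n : Fin (k + N + 1) → M.G) x => ψ.s n x * M.cost n)) _) ?_)
    rw [← mean_const_mul _ fun n => ψ.measurable_t n]
    refine mean_mono fun n x => ?_
    rw [mul_comm (R : ℝ≥0∞)]
    exact mul_le_mul_right (min_le_left _ _) _
  exact (ge_of_tendsto' (tendsto_const_nhds.add (ENNReal.Tendsto.const_mul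
    ((tendsto_add_atTop_iff_nat N).2 (tendsto_mean_t hψ))
      (Or.inr (ENNReal.coe_ne_top (r := R))))) h2).trans_eq (by rw [mul_zero, add_zero])

theorem mean_t_cost_le (hψ : ψ ∈ M.terminating 0) (N : ℕ) :
    M.mean 0 (fun (n : Fin (N + 1) → M.G) x => ψ.t n x * M.cost n) ≤
      ∑' k : ℕ, M.mean 0 (fun (n : Fin (k + N + 1) → M.G) x => ψ.s n x * M.cost n) := by
  rw [mean, ENNReal.tsum_eq_iSup_sum]
  refine iSup_le fun s => ?_
  -- On a finite set of size tuples, truncating at the sum of their costs changes nothing.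
  have hR : ∑ n ∈ s, M.cost n ≠ ∞ := ENNReal.sum_ne_top.2 fun n _ => (M.cost_lt_top n).ne
  refine le_trans ?_ ((ENNReal.sum_le_tsum s).trans
    (mean_t_min_cost_le hψ N (∑ n ∈ s, M.cost n).toNNReal))
  refine Finset.sum_le_sum fun n hn => ?_
  rw [ENNReal.coe_toNNReal hR]
  dsimp only
  rw [min_eq_right (Finset.single_le_sum (f := fun n => M.cost n) (fun _ _ => zero_le) hn)]

theorem tendsto_mean_t_cost (hψ : ψ ∈ M.terminating 0) (hK : M.avgTotalCost 0 ψ ≠ ∞) :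
    Tendsto (fun N => M.mean 0 (fun (n : Fin (N + 1) → M.G) x => ψ.t n x * M.cost n)) atTop
      (nhds 0) := by
  rw [avgTotalCost_eq_tsum_mean] at hK
  exact tendsto_of_tendsto_of_tendsto_of_le_of_le tendsto_const_nhds
    (ENNReal.tendsto_sum_nat_add _ hK) (fun _ => zero_le) (mean_t_cost_le hψ)

theorem initialValue_add_tsum_stoppingExcess (hψ : ψ ∈ M.terminating 0)
    (hK : M.avgTotalCost 0 ψ ≠ ∞) :
    M.initialValue lam₀ lam₁ + ∑' k : ℕ,
        M.mean 0 (fun (n : Fin (k + 1) → M.G) => M.stoppingExcess lam₀ lam₁ ψ n) =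
      ∑' k : ℕ, M.mean 0 (fun (n : Fin (k + 1) → M.G) x =>
        ψ.s n x * (M.cost n + g lam₀ lam₁ (M.ratio n x))) := by
  have h1 : Tendsto (fun N => M.mean 0 (fun (n : Fin (N + 1) → M.G) x =>
        ψ.t n x * (M.cost n + M.V lam₀ lam₁ (N + 1) (M.ratio n x)))) atTop (nhds 0) := by
    have h2 : Tendsto (fun N => M.mean 0 (fun (n : Fin (N + 1) → M.G) x => ψ.t n x * M.cost n) +
        lam₀ * M.mean 0 (fun (n : Fin (N + 1) → M.G) => ψ.t n)) atTop (nhds 0) := by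
      simpa using (tendsto_mean_t_cost hψ hK).add
        (ENNReal.Tendsto.const_mul (tendsto_mean_t hψ) (Or.inr (ENNReal.coe_ne_top (r := lam₀))))
    refine tendsto_of_tendsto_of_tendsto_of_le_of_le tendsto_const_nhds h2 (fun _ => zero_le)
      fun N => ?_
    dsimp only
    rw [← mean_const_mul _ fun n => ψ.measurable_t n,
      ← mean_add fun n => (ψ.measurable_t n).mul_const _]
    refine mean_mono fun n x => ?_
    rw [mul_comm (lam₀ : ℝ≥0∞), ← mul_add]
    exact mul_le_mul_right (add_le_add_right (M.V_le _ _ _ _) _) _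
  refine tendsto_nhds_unique (tendsto_const_nhds.add (ENNReal.tendsto_nat_tsum _)) ?_
  simp only [initialValue_add_sum_stoppingExcess]
  simpa using (ENNReal.tendsto_nat_tsum _).add h1

/-! ### The Lagrangian decomposition and the comparison of tests. -/

theorem tsum_mean_s_eq (ψ : M.Rule) :
    ∑' k : ℕ, M.mean 0 (fun (n : Fin (k + 1) → M.G) x =>
        ψ.s n x * (M.cost n + g lam₀ lam₁ (M.ratio n x))) =
      M.avgTotalCost 0 ψ + ∑' k : ℕ, M.mean 0 (fun (n : Fin (k + 1) → M.G) x =>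
        ψ.s n x * g lam₀ lam₁ (M.ratio n x)) := by
  rw [avgTotalCost_eq_tsum_mean, ← ENNReal.tsum_add]
  refine tsum_congr fun k => ?_
  simp only [mul_add]
  rw [mean_add fun n => (ψ.measurable_s n).mul_const _]

/-- With zero stopping excess, the finite-horizon identity bounds every partial sum of the loss by
`initialValue`. -/
theorem avgTotalCost_ne_top (hS : M.ConditionS lam₀ lam₁ ψ) : M.avgTotalCost 0 ψ ≠ ∞ := by
  refine ne_top_of_le_ne_top (M.initialValue_ne_top (lam₀ := lam₀) (lam₁ := lam₁)) ?_
  refine (le_self_add.trans (tsum_mean_s_eq (lam₀ := lam₀) (lam₁ := lam₁) ψ).ge).trans ?_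
  refine ENNReal.tsum_le_of_sum_range_le fun N => ?_
  refine le_self_add.trans (initialValue_add_sum_stoppingExcess N).ge |>.trans ?_
  rw [Finset.sum_eq_zero fun k _ => ENNReal.tsum_eq_zero.1 (conditionS_iff.1 hS) k, add_zero]

end Stopping

theorem errors_eq (lam₀ lam₁ : ℝ≥0) (ψ φ : M.Rule) :
    lam₀ * M.typeOneError ψ φ + lam₁ * M.typeTwoError ψ φ =
      ∑' k : ℕ, M.mean 0 (fun (n : Fin (k + 1) → M.G) x =>
        ψ.s n x * g lam₀ lam₁ (M.ratio n x)) +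
      ∑' k : ℕ, ∑' n : Fin (k + 1) → M.G, M.sizeProb n * M.decisionExcess lam₀ lam₁ ψ φ n := by
  simp only [typeOneError, typeTwoError, mean, ← ENNReal.tsum_mul_left, ← ENNReal.tsum_add,
    ← mul_add, expect_g_add_decisionExcess]
  refine tsum_congr fun k => tsum_congr fun n => ?_
  ring

/-- The Lagrangian of a test is the optimal value plus the excesses caused by stopping and by the
decision. -/
theorem lagrangian_eq {lam₀ lam₁ : ℝ≥0} {ψ : M.Rule} (hψ : ψ ∈ M.terminating 0)
    (hK : M.avgTotalCost 0 ψ ≠ ∞) (φ : M.Rule) :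
    M.avgTotalCost 0 ψ + (lam₀ * M.typeOneError ψ φ + lam₁ * M.typeTwoError ψ φ) =
      M.initialValue lam₀ lam₁ +
      (∑' k : ℕ, M.mean 0 (fun (n : Fin (k + 1) → M.G) => M.stoppingExcess lam₀ lam₁ ψ n) +
      ∑' k : ℕ, ∑' n : Fin (k + 1) → M.G, M.sizeProb n * M.decisionExcess lam₀ lam₁ ψ φ n) := by
  rw [errors_eq, ← add_assoc, ← tsum_mean_s_eq, ← initialValue_add_tsum_stoppingExcess hψ hK,
    add_assoc]

end GroupSequentialModel

theorem mainTheorem3 {X : Type*} [MeasurableSpace X] (M : GroupSequentialModel X)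
    (lam₀ lam₁ : ℝ≥0) (hlam₀ : 0 < lam₀) (hlam₁ : 0 < lam₁)
    (ψ φ : M.Rule) (hT : (ψ, φ) ∈ M.tests 0)
    (hS : M.ConditionS lam₀ lam₁ ψ) (hD : M.ConditionD lam₀ lam₁ ψ φ)
    (ψ' φ' : M.Rule) (hT' : (ψ', φ') ∈ M.tests 0)
    (hα : M.typeOneError ψ' φ' ≤ M.typeOneError ψ φ)
    (hβ : M.typeTwoError ψ' φ' ≤ M.typeTwoError ψ φ) :
    M.avgTotalCost 0 ψ ≤ M.avgTotalCost 0 ψ' ∧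
    ((M.typeOneError ψ' φ' < M.typeOneError ψ φ ∨ M.typeTwoError ψ' φ' < M.typeTwoError ψ φ) →
      M.avgTotalCost 0 ψ < M.avgTotalCost 0 ψ') ∧
    ((M.typeOneError ψ' φ' = M.typeOneError ψ φ ∧ M.typeTwoError ψ' φ' = M.typeTwoError ψ φ ∧
        M.avgTotalCost 0 ψ' = M.avgTotalCost 0 ψ) →
      M.ConditionS lam₀ lam₁ ψ' ∧ M.ConditionD lam₀ lam₁ ψ' φ') := by
  have hK : M.avgTotalCost 0 ψ ≠ ∞ := GroupSequentialModel.avgTotalCost_ne_top hS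
  have hL := GroupSequentialModel.lagrangian_eq (lam₀ := lam₀) (lam₁ := lam₁) hT hK φ
  rw [GroupSequentialModel.conditionS_iff.1 hS, (GroupSequentialModel.conditionD_iff hlam₁).1 hD,
    add_zero, add_zero] at hL
  -- Finiteness of the weighted errors allows them to be cancelled below.
  have hE : lam₀ * M.typeOneError ψ φ + lam₁ * M.typeTwoError ψ φ ≠ ∞ :=
    ne_top_of_le_ne_top M.initialValue_ne_top (le_add_self.trans hL.le)
  have hα0 : (lam₀ : ℝ≥0∞) ≠ 0 := by simpa using hlam₀.ne'
  have hβ0 : (lam₁ : ℝ≥0∞) ≠ 0 := by simpa using hlam₁.ne'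
  have hα1 := mul_le_mul_right hα (lam₀ : ℝ≥0∞)
  have hβ1 := mul_le_mul_right hβ (lam₁ : ℝ≥0∞)
  have hE' := add_le_add hα1 hβ1
  -- The decomposition requires finite cost; an infinitely costly competitor loses trivially.
  rcases eq_or_ne (M.avgTotalCost 0 ψ') ∞ with hK' | hK'
  · rw [hK']
    exact ⟨le_top, fun _ => hK.lt_top, fun h => absurd h.2.2.symm hK⟩
  have hL' := GroupSequentialModel.lagrangian_eq (lam₀ := lam₀) (lam₁ := lam₁) hT' hK' φ'
  rw [← hL] at hL'
  have hle : M.avgTotalCost 0 ψ ≤ M.avgTotalCost 0 ψ' := by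
    refine (ENNReal.add_le_add_iff_right hE).1 ?_
    exact (le_self_add.trans hL'.ge).trans (add_le_add_right hE' _)
  refine ⟨hle, fun h => ?_, fun ⟨h1, h2, h3⟩ => ?_⟩
  · have hlt : lam₀ * M.typeOneError ψ' φ' + lam₁ * M.typeTwoError ψ' φ' <
        lam₀ * M.typeOneError ψ φ + lam₁ * M.typeTwoError ψ φ := by
      have hE1 := ENNReal.add_ne_top.1 (ne_top_of_le_ne_top hE hE')
      rcases h with h | h
      · exact ENNReal.add_lt_add_of_lt_of_le hE1.2
          ((ENNReal.mul_lt_mul_iff_right hα0 ENNReal.coe_ne_top).2 h) hβ1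
      · exact ENNReal.add_lt_add_of_le_of_lt hE1.1 hα1
          ((ENNReal.mul_lt_mul_iff_right hβ0 ENNReal.coe_ne_top).2 h)
    refine lt_of_not_ge fun hge => ?_
    exact ((le_self_add.trans hL'.ge).trans_lt
      (ENNReal.add_lt_add_of_le_of_lt hK' hge hlt)).false
  · rw [h1, h2, h3] at hL'
    -- Equal Lagrangians leave a zero sum of the competitor's two excesses.
    have h0 := (ENNReal.add_right_inj (ENNReal.add_ne_top.2 ⟨hK, hE⟩)).1 ((add_zero _).trans hL')
    have h0' := add_eq_zero.1 h0.symm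
    exact ⟨GroupSequentialModel.conditionS_iff.2 h0'.1,
      (GroupSequentialModel.conditionD_iff hlam₁).2 h0'.2⟩
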